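/- Let $G$ be a torsion-free discrete group and let $\iota\colon H\hookrightarrow G$ be the inclusion of a subgroup $H$. By a $K(\Gamma,1)$ we mean a path-connected CW complex with fundamental group isomorphic to $\Gamma$ and with contractible universal covering space. By a $K(\iota,1)$ we mean a covering map $q\colon K(H,1)\to K(G,1)$ between spaces of type $K(H,1)$ and $K(G,1)$ that induces $\iota$: for some base point $y$ of $K(H,1)$ and some identifications $\pi_1(K(H,1),y)\cong H$ and $\pi_1(K(G,1),q(y))\cong G$, the homomorphism $\pi_1(q)$ is $\iota$. By a model of $EG$ we mean a contractible $G$-CW complex on which $G$ acts freely. The coset space $G/H$ is regarded as a discrete $G$-space under left translation. The sectional category $\operatorname{secat}(f)$ of a continuous map $f\colon Y\to X$ is the smallest integer $k\ge 0$ for which there are an open cover $U_0,\dots,U_k$ of $X$ and continuous maps $s_i\colon U_i\to Y$ such that $f\circ s_i$ is homotopic to the inclusion $U_i\hookrightarrow X$ for every $0\le i\le k$; it is $\infty$ if there is no such $k$. For a family $\mathcal A$ of $G$-spaces, the $\mathcal A$-genus of a $G$-space $Z$ is the smallest integer $k\ge 0$ for which there is a cover of $Z$ by open $G$-invariant subsets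 $U_0,\dots,U_k$ such that for every $0\le i\le k$ there are $A_i\in\mathcal A$ and a continuous $G$-equivariant map $U_i\to A_i$; it is $\infty$ if there is no such $k$. Then, for every covering map $K(\iota,1)\colon K(H,1)\to K(G,1)$ as above and every model of $EG$, the sectional category $\operatorname{secat}(H\hookrightarrow G):=\operatorname{secat}\big(K(\iota,1)\big)$ of the subgroup inclusion satisfies $$\operatorname{secat}(H\hookrightarrow G)=\mathcal A\text{-genus}(EG),\qquad \mathcal A=\{G/H\}.$$ -/

import Mathlib

open Topology Set
open scoped Pointwise

/-- `SecatLE f k`: the base `X` of `f : Y → X` has an open cover `U₀, …, U_k` with continuous maps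
`sᵢ : Uᵢ → Y` such that `f ∘ sᵢ` is homotopic to the inclusion `Uᵢ ↪ X`. -/
def SecatLE {Y X : Type*} [TopologicalSpace Y] [TopologicalSpace X] (f : C(Y, X)) (k : ℕ) : Prop :=
  ∃ U : Fin (k + 1) → Set X, (∀ i, IsOpen (U i)) ∧ (⋃ i, U i) = univ ∧
    ∀ i, ∃ s : C(U i, Y),
      (f.comp s).Homotopic (⟨Subtype.val, continuous_subtype_val⟩ : C(U i, X))

/-- The (reduced) sectional category of a map: the smallest `k ≥ 0` with `SecatLE f k`,
and `∞` if there is no such `k`. -/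
noncomputable def secat {Y X : Type*} [TopologicalSpace Y] [TopologicalSpace X]
    (f : C(Y, X)) : ℕ∞ :=
  ⨅ (k : ℕ) (_ : SecatLE f k), (k : ℕ∞)

/-- `GenusLE G A X k`: the `G`-space `X` has a cover `U₀, …, U_k` by `G`-invariant open subsets such
that each `Uᵢ` admits a continuous `G`-equivariant map to some member of the family `A`
of `G`-spaces. -/
def GenusLE (G : Type*) [Group G] {J : Type*} (A : J → Type*) [∀ j, TopologicalSpace (A j)]
    [∀ j, MulAction G (A j)] (X : Type*) [TopologicalSpace X] [MulAction G X] (k : ℕ) : Prop :=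
  ∃ U : Fin (k + 1) → Set X,
    (∀ i, IsOpen (U i)) ∧ (⋃ i, U i) = univ ∧ (∀ i (g : G), ∀ x ∈ U i, g • x ∈ U i) ∧
    ∀ i, ∃ (j : J) (φ : C(U i, A j)),
      ∀ (g : G) (x y : U i), (y : X) = g • (x : X) → φ y = g • φ x

/-- The (reduced) `𝒜`-genus of the `G`-space `X`, for the family `𝒜 = {A j}` of `G`-spaces:
the smallest `k ≥ 0` with `GenusLE G A X k`, and `∞` if there is no such `k`. -/
noncomputable def genus (G : Type*) [Group G] {J : Type*} (A : J → Type*)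
    [∀ j, TopologicalSpace (A j)] [∀ j, MulAction G (A j)]
    (X : Type*) [TopologicalSpace X] [MulAction G X] : ℕ∞ :=
  ⨅ (k : ℕ) (_ : GenusLE G A X k), (k : ℕ∞)

/-- `X` is a `G`-CW complex for the discrete group `G`: a Hausdorff space with an action of `G` by
homeomorphisms and a CW structure whose open cells are permuted by `G`, such that an element which
maps an open cell to itself fixes this cell pointwise. -/
structure IsGCWComplex (G : Type*) [Group G] (X : Type*) [TopologicalSpace X] [MulAction G X] :
    Prop where
  t2Space : T2Space X
  continuousConstSMul : ContinuousConstSMul G X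
  exists_cw : ∃ _ : CWComplex (univ : Set X),
    (∀ (g : G) (n : ℕ) (e : RelCWComplex.cell (univ : Set X) n),
      ∃ e' : RelCWComplex.cell (univ : Set X) n,
        g • RelCWComplex.openCell n e = RelCWComplex.openCell n e') ∧
    (∀ (g : G) (n : ℕ) (e : RelCWComplex.cell (univ : Set X) n),
      g • RelCWComplex.openCell n e = RelCWComplex.openCell n e →
        ∀ x ∈ RelCWComplex.openCell n e, g • x = x)

/-- `E` is a model of `EG` for the discrete group `G`: a contractible free `G`-CW complex. -/
structure IsEG (G : Type*) [Group G] (E : Type*) [TopologicalSpace E] [MulAction G E] :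
    Prop where
  isGCWComplex : IsGCWComplex G E
  stabilizer_eq_bot : ∀ x : E, MulAction.stabilizer G x = ⊥
  contractibleSpace : ContractibleSpace E

/-- `X` is an Eilenberg–MacLane space `K(G, 1)`: a path-connected CW complex with fundamental group
isomorphic to `G` and with a contractible universal covering space. -/
structure IsEilenbergMacLane.{u, v} (G : Type u) [Group G] (X : Type v) [TopologicalSpace X] :
    Prop where
  t2Space : T2Space X
  nonempty_cw : Nonempty (CWComplex (univ : Set X))
  pathConnectedSpace : PathConnectedSpace X
  nonempty_mulEquiv : ∀ x : X, Nonempty (FundamentalGroup X x ≃* G)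
  exists_cover : ∃ (X' : Type v) (_ : TopologicalSpace X') (p : X' → X),
    IsCoveringMap p ∧ ContractibleSpace X'

/-- `q : Y → X` is a covering map `K(ι, 1) : K(H, 1) → K(G, 1)` induced by the inclusion
`ι : H ↪ G`: for suitable base points and identifications `π₁(Y) ≅ H` and `π₁(X) ≅ G`,
the homomorphism `π₁(q)` is `ι`. -/
structure IsEilenbergMacLaneMap {G : Type*} [Group G] (H : Subgroup G) {Y X : Type*}
    [TopologicalSpace Y] [TopologicalSpace X] (q : C(Y, X)) : Prop where
  source : IsEilenbergMacLane H Y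
  target : IsEilenbergMacLane G X
  isCoveringMap : IsCoveringMap q
  exists_induces : ∃ (y : Y) (a : FundamentalGroup Y y ≃* H) (b : FundamentalGroup X (q y) ≃* G),
    ∀ γ : FundamentalGroup Y y, b (FundamentalGroup.map q y γ) = (a γ : G)

/-! Let `p : Z → X` be the contractible universal cover of the K(G,1) space `X`. Deck
transformations make `Z` a free `G`-space with orbit space `X`, and the K(H,1) space `Y` is the
intermediate cover Z/H. A homotopy section of `q` over an open V lifts to a strict one, and strict
sections of Z/H → Z/G over V amount to equivariant maps p⁻¹(V) → G/H. Since open subsets of `X`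
correspond to invariant open subsets of `Z`, the sectional category of `q` is the genus of `Z`
(`secatLE_iff_genusLE`).

The given model `E` need not be `Z`, but the genus is monotone along equivariant maps, so one map in
each direction suffices and no equivariant homotopy equivalence is needed. Both maps are built cell
by cell: extending over a free cell into a contractible target meets no obstruction
(`exists_equivariant_map_of_freeCells`). The free cells of `E` come from its G-CW structure, those
of `Z` are lifts of the characteristic maps of `X`. -/

/-! ### Extension over free cells -/

/-- A continuous map from the unit sphere to a contractible space extends to the unit ball. -/
theorem exists_continuousOn_closedBall_extension {V W : Type*} [NormedAddCommGroup V]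
    [NormedSpace ℝ V] [TopologicalSpace W] [ContractibleSpace W] {f : V → W}
    (hf : ContinuousOn f (Metric.sphere 0 1)) :
    ∃ h : V → W, ContinuousOn h (Metric.closedBall 0 1) ∧ EqOn h f (Metric.sphere 0 1) := by
  classical
  obtain ⟨w₀, ⟨F⟩⟩ := id_nullhomotopic W
  let A : Set V := {x | ‖x‖ ≤ 1 / 2}
  let B : Set V := {x | 1 / 2 ≤ ‖x‖}
  -- The contraction runs from the identity on the unit sphere (time 0) to the constant `w₀` at
  -- radius 1/2 (time 1); the constant inner ball keeps the normalisation away from the origin.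
  let k : V → W := fun x ↦ F (projIcc 0 1 zero_le_one (2 - 2 * ‖x‖), f (‖x‖⁻¹ • x))
  let h : V → W := fun x ↦ if ‖x‖ ≤ 1 / 2 then w₀ else k x
  have hk : ContinuousOn k B := by
    refine F.continuous.comp_continuousOn (ContinuousOn.prodMk ?_ ?_)
    · exact (continuous_projIcc.comp (by fun_prop)).continuousOn
    · refine hf.comp (ContinuousOn.smul (continuous_norm.continuousOn.inv₀ ?_) continuousOn_id) ?_
      · intro x (hx : 1 / 2 ≤ ‖x‖); linarith
      · intro x (hx : 1 / 2 ≤ ‖x‖)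
        have : ‖x‖ ≠ 0 := by linarith
        simp [norm_smul, this]
  have hkB : EqOn h k B := by
    intro x (hx : 1 / 2 ≤ ‖x‖)
    by_cases hx' : ‖x‖ ≤ 1 / 2
    · have : ‖x‖ = 1 / 2 := le_antisymm hx' hx
      have h1 : projIcc (0 : ℝ) 1 zero_le_one (2 - 2 * ‖x‖) = 1 := by
        rw [this]; exact projIcc_of_right_le _ (by norm_num)
      simp only [h, k, if_pos hx', h1]
      exact (F.apply_one _).symm
    · simp only [h, if_neg hx']
  have hcont : ContinuousOn h (A ∪ B) := by
    refine ContinuousOn.union_of_isClosed ?_ (hk.congr hkB) (isClosed_le (by fun_prop) (by fun_prop))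
      (isClosed_le (by fun_prop) (by fun_prop))
    exact continuousOn_const.congr fun x (hx : ‖x‖ ≤ 1 / 2) ↦ if_pos hx
  refine ⟨h, hcont.mono fun x _ ↦ le_total ‖x‖ (1 / 2), fun x hx ↦ ?_⟩
  have hx1 : ‖x‖ = 1 := by simpa using hx
  have h0 : projIcc (0 : ℝ) 1 zero_le_one (2 - 2 * ‖x‖) = 0 := by
    rw [hx1]; exact projIcc_of_le_left _ (by norm_num)
  rw [hkB (show 1 / 2 ≤ ‖x‖ by rw [hx1]; norm_num)]
  simp only [k, h0]
  rw [hx1, inv_one, one_smul]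
  exact F.apply_zero _

/-- Obstruction-free cellular extension: a free `G`-space `Z` built from free `G`-cells maps
equivariantly to every contractible `G`-space `W`. The cells are the maps `φ i`; the topology of `Z`
enters through the hypotheses `frontier` and `weak`. -/
theorem exists_equivariant_map_of_freeCells {G Z W I : Type*} [Group G] [TopologicalSpace Z]
    [MulAction G Z] [TopologicalSpace W] [MulAction G W] [ContinuousConstSMul G W]
    [ContractibleSpace W] (dim : I → ℕ) (φ : ∀ i, (Fin (dim i) → ℝ) → Z)
    (bij : Function.Bijective
      (fun x : G × (Σ i, Metric.ball (0 : Fin (dim i) → ℝ) 1) ↦ x.1 • φ x.2.1 x.2.2))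
    (sphere_lt : ∀ i, ∀ d ∈ Metric.sphere (0 : Fin (dim i) → ℝ) 1, ∃ (g : G) (j : I),
      dim j < dim i ∧ ∃ d' ∈ Metric.ball (0 : Fin (dim j) → ℝ) 1, g • φ j d' = φ i d)
    (frontier : ∀ f : Z → W, (∀ (g : G) z, f (g • z) = g • f z) → ∀ i,
      (∀ j, dim j < dim i → ContinuousOn (f ∘ φ j) (Metric.closedBall 0 1)) →
      ContinuousOn (f ∘ φ i) (Metric.sphere 0 1))
    (weak : ∀ f : Z → W, (∀ (g : G) z, f (g • z) = g • f z) →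
      (∀ i, ContinuousOn (f ∘ φ i) (Metric.closedBall 0 1)) → Continuous f) :
    ∃ f : C(Z, W), ∀ (g : G) z, f (g • z) = g • f z := by
  classical
  let e := Equiv.ofBijective _ bij
  have he (g : G) (i : I) (d) (hd : d ∈ Metric.ball 0 1) :
      e.symm (g • φ i d) = (g, ⟨i, ⟨d, hd⟩⟩) := e.symm_apply_apply (g, ⟨i, ⟨d, hd⟩⟩)
  have he' (z : Z) : ∃ (g : G) (i : I) (d : _), ∃ _ : d ∈ Metric.ball 0 1, z = g • φ i d := by
    obtain ⟨⟨g, i, d, hd⟩, rfl⟩ := bij.2 z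
    exact ⟨g, i, d, hd, rfl⟩
  let dimz : Z → ℕ := fun z ↦ dim (e.symm z).2.1
  have dimz_smul (g : G) (i : I) (d) (hd : d ∈ Metric.ball 0 1) : dimz (g • φ i d) = dim i := by
    simp only [dimz, he g i d hd]
  have dimz_ball (i : I) (d) (hd : d ∈ Metric.ball 0 1) : dimz (φ i d) = dim i := by
    simpa using dimz_smul 1 i d hd
  have dimz_sphere (i : I) (d) (hd : d ∈ Metric.sphere 0 1) : dimz (φ i d) < dim i := by
    obtain ⟨g, j, hj, d', hd', h⟩ := sphere_lt i d hd
    rwa [← h, dimz_smul g j d' hd']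
  have dimz_le (i : I) (d) (hd : d ∈ Metric.closedBall 0 1) : dimz (φ i d) ≤ dim i := by
    rw [← Metric.sphere_union_ball] at hd
    exact hd.elim (fun h ↦ (dimz_sphere i d h).le) (fun h ↦ (dimz_ball i d h).le)
  have dimz_equiv (g : G) (z : Z) : dimz (g • z) = dimz z := by
    obtain ⟨k, i, d, hd, rfl⟩ := he' z
    rw [← mul_smul, dimz_smul _ _ _ hd, dimz_smul _ _ _ hd]
  -- Nothing is asked on cells of dimension at least `n`: there `f` may be discontinuous, which lets
  -- every stage be a function on all of `Z`.
  let P : ℕ → (Z → W) → Prop := fun n f ↦ (∀ (g : G) z, f (g • z) = g • f z) ∧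
    ∀ i, dim i < n → ContinuousOn (f ∘ φ i) (Metric.closedBall 0 1)
  have step (n : ℕ) (f : {f // P n f}) :
      ∃ f' : {f // P (n + 1) f}, ∀ z, dimz z < n → f'.1 z = f.1 z := by
    obtain ⟨f, hf, hfc⟩ := f
    have (i : I) : ∃ h : (Fin (dim i) → ℝ) → W,
        (dim i = n → ContinuousOn h (Metric.closedBall 0 1)) ∧
        EqOn h (f ∘ φ i) (Metric.sphere 0 1) ∧ (dim i ≠ n → h = f ∘ φ i) := by
      by_cases hi : dim i = n
      · obtain ⟨h, h1, h2⟩ := exists_continuousOn_closedBall_extension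
          (frontier f hf i fun j hj ↦ hfc j (hi ▸ hj))
        exact ⟨h, fun _ ↦ h1, h2, fun h ↦ absurd hi h⟩
      · exact ⟨f ∘ φ i, fun h ↦ absurd h hi, fun _ _ ↦ rfl, fun _ ↦ rfl⟩
    choose h hcont hsphere hne using this
    -- Freeness enters here: by `bij` each point has unique coordinates, so values chosen on the
    -- representative open cells spread over `Z` by translation.
    let K : G × (Σ i, Metric.ball (0 : Fin (dim i) → ℝ) 1) → W := fun x ↦ x.1 • h x.2.1 x.2.2.1
    let f' : Z → W := fun z ↦ K (e.symm z)
    have f'_apply (g : G) (i : I) (d) (hd : d ∈ Metric.ball 0 1) :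
        f' (g • φ i d) = g • h i d := congrArg K (he g i d hd)
    have f'_lt (z : Z) (hz : dimz z ≠ n) : f' z = f z := by
      obtain ⟨g, i, d, hd, rfl⟩ := he' z
      rw [dimz_smul _ _ _ hd] at hz
      rw [f'_apply _ _ _ hd, hne i hz, hf]; rfl
    refine ⟨⟨f', ?_, ?_⟩, fun z hz ↦ f'_lt z hz.ne⟩
    · intro g z
      obtain ⟨k, i, d, hd, rfl⟩ := he' z
      rw [← mul_smul, f'_apply _ _ _ hd, f'_apply _ _ _ hd, mul_smul]
    · intro i hi
      rcases Nat.lt_succ_iff_lt_or_eq.mp hi with hi | hi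
      · exact (hfc i hi).congr fun d hd ↦ f'_lt _ ((dimz_le i d hd).trans_lt hi).ne
      · refine (hcont i hi).congr fun d hd ↦ ?_
        rw [← Metric.sphere_union_ball] at hd
        rcases hd with hd | hd
        · rw [hsphere i hd]
          exact f'_lt _ (hi ▸ dimz_sphere i d hd).ne
        · simpa using f'_apply 1 i d hd
  choose next hnext using step
  let w₀ : W := Classical.arbitrary W
  have base : P 0 (fun z ↦ (e.symm z).1 • w₀) := by
    refine ⟨fun g z ↦ ?_, fun i hi ↦ absurd hi (Nat.not_lt_zero _)⟩
    obtain ⟨k, i, d, hd, rfl⟩ := he' z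
    simp only [← mul_smul, he _ _ _ hd]
  let F : ∀ n, {f // P n f} := fun n ↦ Nat.rec ⟨fun z ↦ (e.symm z).1 • w₀, base⟩ next n
  have F_add (z : Z) (m : ℕ) : (F (dimz z + 1 + m)).1 z = (F (dimz z + 1)).1 z := by
    induction m with
    | zero => rfl
    | succ m ih => exact (hnext _ (F (dimz z + 1 + m)) z (by omega)).trans ih
  have F_eq (z : Z) (m : ℕ) (hm : dimz z < m) : (F m).1 z = (F (dimz z + 1)).1 z := by
    obtain ⟨k, rfl⟩ := Nat.exists_eq_add_of_le (Nat.succ_le_of_lt hm)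
    exact F_add z k
  -- The stages are constant at `z` from index `dimz z + 1` on, since `P n` governs only dimensions
  -- below `n`.
  let f : Z → W := fun z ↦ (F (dimz z + 1)).1 z
  have hf (g : G) (z : Z) : f (g • z) = g • f z := by
    change (F (dimz (g • z) + 1)).1 (g • z) = _
    rw [dimz_equiv]
    exact (F (dimz z + 1)).2.1 g z
  refine ⟨⟨f, weak f hf fun i ↦ ?_⟩, hf⟩
  exact ((F (dim i + 1)).2.2 i (Nat.lt_succ_self _)).congr fun d hd ↦
    (F_eq _ _ (Nat.lt_succ_of_le (dimz_le i d hd))).symm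

/-! ### Point-set topology of CW complexes -/

namespace Topology.CWComplex

variable {X : Type*} [TopologicalSpace X] [CWComplex (univ : Set X)]

/-- A function on an open subset `V` of a CW complex, restricted to a set `T` whose topology is
determined by a family `J` of cells, is continuous if it is so along the characteristic maps. -/
theorem continuousOn_inter_of_comp_map [T2Space X] {W : Type*} [TopologicalSpace W] {T : Set X}
    {J : Set (Σ n, cell (univ : Set X) n)}
    (hJ : ∀ c ∈ J, closedCell c.1 c.2 ⊆ T)
    (hT : ∀ A ⊆ T, (∀ c ∈ J, IsClosed (A ∩ closedCell c.1 c.2)) → IsClosed A)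
    {f : X → W} {V : Set X} (hV : IsOpen V)
    (hf : ∀ c ∈ J, ContinuousOn (f ∘ map c.1 c.2)
      (Metric.closedBall 0 1 ∩ map c.1 c.2 ⁻¹' V)) : ContinuousOn f (T ∩ V) := by
  rw [continuousOn_iff']
  intro O hO
  -- The bad set meets each closed cell in the image of a compact part of the ball, so it is closed
  -- by the weak topology.
  have hA : IsClosed (T \ (V ∩ f ⁻¹' O)) := by
    refine hT _ sdiff_subset fun c hc ↦ ?_
    obtain ⟨u, hu, huV⟩ := continuousOn_iff'.mp
      (RelCWComplex.continuousOn (C := (univ : Set X)) c.1 c.2) V hV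
    obtain ⟨u', hu', huO⟩ := continuousOn_iff'.mp (hf c hc) O hO
    have : (T \ (V ∩ f ⁻¹' O)) ∩ closedCell c.1 c.2 =
        map c.1 c.2 '' (Metric.closedBall 0 1 \ (u ∩ u')) := by
      ext x
      constructor
      · rintro ⟨⟨hxT, hx⟩, d, hd, rfl⟩
        refine ⟨d, ⟨hd, fun hd' ↦ hx ?_⟩, rfl⟩
        have h1 : map c.1 c.2 d ∈ V := (huV.ge ⟨hd'.1, hd⟩).1
        exact ⟨h1, (huO.ge ⟨hd'.2, hd, h1⟩).1⟩
      · rintro ⟨d, ⟨hd, hdu⟩, rfl⟩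
        have hc' : map c.1 c.2 d ∈ closedCell c.1 c.2 := mem_image_of_mem _ hd
        refine ⟨⟨hJ c hc hc', fun hx ↦ hdu ?_⟩, hc'⟩
        exact ⟨(huV.le ⟨hx.1, hd⟩).1, (huO.le ⟨hx.2, hd, hx.1⟩).1⟩
    rw [this]
    refine (((isCompact_closedBall _ _).diff (hu.inter hu')).image_of_continuousOn ?_).isClosed
    exact (RelCWComplex.continuousOn (C := (univ : Set X)) c.1 c.2).mono sdiff_subset
  refine ⟨V ∩ (T \ (V ∩ f ⁻¹' O))ᶜ, hV.inter hA.isOpen_compl, ?_⟩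
  ext x; simp only [mem_inter_iff, mem_preimage, mem_compl_iff, mem_sdiff]; tauto

theorem isClosed_of_isClosed_inter_closedCell {A : Set X}
    (hA : ∀ c ∈ (univ : Set (Σ n, cell (univ : Set X) n)), IsClosed (A ∩ closedCell c.1 c.2)) :
    IsClosed A :=
  CWComplex.closed' (C := (univ : Set X)) A (subset_univ _) fun n j ↦ hA ⟨n, j⟩ trivial

theorem isClosed_of_subset_finite_iUnion_closedCell {J : Set (Σ n, cell (univ : Set X) n)}
    (hJ : J.Finite) {A : Set X} (hAT : A ⊆ ⋃ c ∈ J, closedCell c.1 c.2)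
    (hA : ∀ c ∈ J, IsClosed (A ∩ closedCell c.1 c.2)) : IsClosed A := by
  rw [← inter_eq_left.mpr hAT, inter_iUnion₂]
  exact hJ.isClosed_biUnion hA

/-- The frontier of a cell lies in the union of a finite set of cells of lower dimension. -/
theorem exists_finite_cellFrontier_subset (c : Σ n, cell (univ : Set X) n) :
    ∃ J : Set (Σ n, cell (univ : Set X) n), J.Finite ∧ (∀ c' ∈ J, c'.1 < c.1) ∧
      cellFrontier c.1 c.2 ⊆ ⋃ c' ∈ J, closedCell c'.1 c'.2 := by
  obtain ⟨I, hI⟩ := cellFrontier_subset_finite_closedCell c.1 c.2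
  refine ⟨⋃ m ∈ Finset.range c.1, ⋃ j ∈ I m, {⟨m, j⟩}, ?_, ?_, ?_⟩
  · exact Set.Finite.biUnion (Finset.finite_toSet _) fun m _ ↦
      Set.Finite.biUnion (Finset.finite_toSet _) fun j _ ↦ finite_singleton _
  · intro c' hc'
    simp only [mem_iUnion, mem_singleton_iff, Finset.mem_range] at hc'
    obtain ⟨m, hm, j, -, rfl⟩ := hc'
    exact hm
  · intro x hx
    obtain ⟨m, hm, j, hj, hx⟩ := by simpa only [mem_iUnion] using hI hx
    simp only [mem_iUnion]
    refine ⟨⟨m, j⟩, ⟨m, Finset.mem_range.mpr hm, j, hj, rfl⟩, hx⟩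

theorem exists_mem_openCell (x : X) : ∃ c : Σ n, cell (univ : Set X) n, x ∈ openCell c.1 c.2 := by
  have := (iUnion_openCell_eq_complex (C := (univ : Set X))).ge (mem_univ x)
  obtain ⟨n, j, h⟩ := by simpa only [mem_iUnion] using this
  exact ⟨⟨n, j⟩, h⟩

theorem exists_mem_openCell_of_mem_cellFrontier {c : Σ n, cell (univ : Set X) n} {x : X}
    (hx : x ∈ cellFrontier c.1 c.2) :
    ∃ c' : Σ n, cell (univ : Set X) n, c'.1 < c.1 ∧ x ∈ openCell c'.1 c'.2 := by
  obtain ⟨I, hI⟩ := cellFrontier_subset_finite_openCell c.1 c.2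
  obtain ⟨m, hm, j, hj, hx⟩ := by simpa only [mem_iUnion] using hI hx
  exact ⟨⟨m, j⟩, hm, hx⟩

theorem eq_of_mem_openCell {c c' : Σ n, cell (univ : Set X) n} {x : X}
    (h : x ∈ openCell c.1 c.2) (h' : x ∈ openCell c'.1 c'.2) : c = c' :=
  eq_of_not_disjoint_openCell (not_disjoint_iff.mpr ⟨x, h, h'⟩)

theorem injOn_map (c : Σ n, cell (univ : Set X) n) : InjOn (map c.1 c.2) (Metric.ball 0 1) := by
  have := (map c.1 c.2).injOn
  rwa [RelCWComplex.source_eq (C := (univ : Set X))] at this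

/-- The retraction of a normed space onto its unit ball. -/
noncomputable def clamp {V : Type*} [NormedAddCommGroup V] [NormedSpace ℝ V] (x : V) : V :=
  (max 1 ‖x‖)⁻¹ • x

section clamp
variable {V : Type*} [NormedAddCommGroup V] [NormedSpace ℝ V]

theorem continuous_clamp : Continuous (clamp : V → V) := by
  refine Continuous.smul (Continuous.inv₀ (by fun_prop) fun x ↦ ?_) continuous_id
  exact (lt_max_of_lt_left zero_lt_one).ne'

theorem clamp_mem (x : V) : clamp x ∈ Metric.closedBall (0 : V) 1 := by
  have h : 0 < max 1 ‖x‖ := lt_max_of_lt_left zero_lt_one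
  rw [mem_closedBall_zero_iff, clamp, norm_smul, norm_inv, Real.norm_of_nonneg h.le,
    inv_mul_le_iff₀ h, mul_one]
  exact le_max_right _ _

theorem clamp_of_mem {x : V} (hx : x ∈ Metric.closedBall (0 : V) 1) : clamp x = x := by
  rw [mem_closedBall_zero_iff] at hx
  simp [clamp, max_eq_left hx]

end clamp

theorem continuous_map_clamp (c : Σ n, cell (univ : Set X) n) :
    Continuous fun d ↦ map c.1 c.2 (clamp d) :=
  (RelCWComplex.continuousOn (C := (univ : Set X)) c.1 c.2).comp_continuous continuous_clamp
    clamp_mem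

-- Clamping extends each characteristic map to a whole Euclidean space, so the complex is a quotient
-- of a disjoint union of Euclidean spaces; local path-connectedness passes to quotients.
variable (X) in
theorem locallyPathConnectedSpace [T2Space X] : LocallyPathConnectedSpace X := by
  let F : (Σ c : Σ n, cell (univ : Set X) n, (Fin c.1 → ℝ)) → X :=
    fun x ↦ map x.1.1 x.1.2 (clamp x.2)
  have hF : Continuous F := continuous_sigma fun c ↦ continuous_map_clamp c
  refine IsQuotientMap.locallyPathConnectedSpace (f := F) ?_
  rw [isQuotientMap_iff_isClosed]
  refine ⟨fun x ↦ ?_, fun A ↦ ⟨fun h ↦ h.preimage hF, fun h ↦ ?_⟩⟩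
  · obtain ⟨c, d, hd, rfl⟩ := exists_mem_openCell x
    exact ⟨⟨c, d⟩, by simp only [F, clamp_of_mem (Metric.ball_subset_closedBall hd)]⟩
  · refine isClosed_of_isClosed_inter_closedCell fun c _ ↦ ?_
    have hS : IsClosed {d : Fin c.1 → ℝ | map c.1 c.2 (clamp d) ∈ A} :=
      IsClosed.preimage (f := Sigma.mk c) continuous_sigmaMk h
    have hK := (isCompact_closedBall (0 : Fin c.1 → ℝ) 1).inter_right hS
    convert (hK.image (continuous_map_clamp c)).isClosed using 1
    ext x
    constructor
    · rintro ⟨hx, d, hd, rfl⟩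
      exact ⟨d, ⟨hd, by simpa [F, clamp_of_mem hd] using hx⟩, by simp only [clamp_of_mem hd]⟩
    · rintro ⟨d, ⟨hd, hx⟩, rfl⟩
      exact ⟨hx, mem_image_of_mem _ (clamp_mem d)⟩

end Topology.CWComplex

/-! ### Monodromy and deck transformations -/

namespace IsCoveringMap

variable {Z X Y : Type*} [TopologicalSpace Z] [TopologicalSpace X] [TopologicalSpace Y]
  {p : Z → X} {q : Y → X}

/-- Monodromy is natural with respect to maps of covering spaces. -/
theorem monodromy_map_apply (hp : IsCoveringMap p) (hq : IsCoveringMap q) (r : C(Z, Y))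
    (hr : ∀ z, q (r z) = p z) {x y : X} (γ : Path.Homotopic.Quotient x y) (z : p ⁻¹' {x})
    (w : q ⁻¹' {x}) (hw : r z = w) :
    (hq.monodromy γ w : Y) = r (hp.monodromy γ z) := by
  obtain ⟨γ⟩ := γ
  have h0 : γ 0 = p z := γ.source.trans z.2.symm
  have h0' : γ 0 = q w := γ.source.trans w.2.symm
  have : r.comp (hp.liftPath γ z h0) = hq.liftPath γ w h0' := by
    rw [hq.eq_liftPath_iff']
    refine ⟨?_, (congrArg r (hp.liftPath_zero ..)).trans hw⟩
    ext t
    exact (hr _).trans congr($(hp.liftPath_lifts γ z h0) t)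
  exact congr($this 1).symm

theorem exists_map_eq_of_monodromy_eq (hp : IsCoveringMap p) {x y : X}
    (γ : Path.Homotopic.Quotient x y) (z : p ⁻¹' {x}) (w : p ⁻¹' {y}) (h : hp.monodromy γ z = w) :
    ∃ δ : Path.Homotopic.Quotient z.1 w.1, δ.map ⟨p, hp.continuous⟩ = γ.cast z.2 w.2 := by
  subst h
  exact ⟨_, hp.map_liftPathQuotient γ z⟩

theorem exists_monodromy_eq [PathConnectedSpace Z] (hp : IsCoveringMap p) {x y : X}
    (z : p ⁻¹' {x}) (w : p ⁻¹' {y}) :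
    ∃ γ : Path.Homotopic.Quotient x y, hp.monodromy γ z = w := by
  obtain ⟨z, rfl⟩ := z
  obtain ⟨w, rfl⟩ := w
  exact ⟨_, hp.monodromy_map (.mk (PathConnectedSpace.somePath z w))⟩

/-- The lift is a loop in a simply connected space, hence trivial, and so is its image. This gives
freeness of the deck action. -/
theorem eq_refl_of_monodromy_eq [SimplyConnectedSpace Z] (hp : IsCoveringMap p) {x : X}
    (γ : Path.Homotopic.Quotient x x) (z : p ⁻¹' {x}) (h : hp.monodromy γ z = z) :
    γ = .refl x := by
  obtain ⟨δ, hδ⟩ := hp.exists_map_eq_of_monodromy_eq γ z z h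
  obtain ⟨z, rfl⟩ := z
  rw [Subsingleton.elim δ (.refl z)] at hδ
  exact (Path.Homotopic.Quotient.cast_rfl_rfl γ).symm.trans hδ.symm

/-- A covering map may a priori have empty fibres; path lifting from one nonempty fibre rules this
out. -/
theorem surjective_of_pathConnectedSpace [Nonempty Z] [PathConnectedSpace X]
    (hp : IsCoveringMap p) : Function.Surjective p := by
  intro x
  let z : Z := Classical.arbitrary Z
  let γ := PathConnectedSpace.somePath (p z) x
  exact ⟨_, (hp.monodromy (.mk γ) ⟨z, rfl⟩).2⟩

theorem locallyPathConnectedSpace [LocallyPathConnectedSpace X] (hp : IsCoveringMap p) :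
    LocallyPathConnectedSpace Z := by
  choose e he using hp.isLocalHomeomorph
  let _ : ChartedSpace X Z :=
    { atlas := range e
      chartAt := e
      mem_chart_source := fun z ↦ (he z).1
      chart_mem_atlas := fun z ↦ mem_range_self z }
  exact ChartedSpace.locallyPathConnectedSpace X Z

/-- The group `G` acts freely on the simply connected cover `p : Z → X`, transitively on fibres, and
the intermediate cover `Y` is the quotient of `Z` by the subgroup `H` which is the image of the
fundamental group of `Y`. -/
theorem exists_mulAction_of_simplyConnectedSpace {G : Type*} [Group G] (H : Subgroup G)
    [SimplyConnectedSpace Z] [LocallyPathConnectedSpace Z] [PathConnectedSpace X]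
    [PathConnectedSpace Y] (hp : IsCoveringMap p) (q : C(Y, X)) (hq : IsCoveringMap q) (y : Y)
    (b : FundamentalGroup X (q y) ≃* G)
    (hb : ∀ γ, b γ ∈ H ↔ γ ∈ (FundamentalGroup.map q y).range) :
    ∃ (_ : MulAction G Z) (r : C(Z, Y)), ContinuousConstSMul G Z ∧
      (∀ z z', p z = p z' ↔ ∃ g : G, g • z = z') ∧ (∀ (g : G) (z : Z), g • z = z → g = 1) ∧
      (∀ z, q (r z) = p z) ∧ Function.Surjective r ∧ ∀ (g : G) z, r (g • z) = r z ↔ g ∈ H := by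
  obtain ⟨z₀, hz₀⟩ := hp.surjective_of_pathConnectedSpace (q y)
  let P : C(Z, X) := ⟨p, hp.continuous⟩
  let e₀ : p ⁻¹' {q y} := ⟨z₀, hz₀⟩
  have lift (z z' : Z) (h : p z = p z') : ∃ F : C(Z, Z), F z = z' ∧ p ∘ F = p := by
    obtain ⟨F, hF, -⟩ := hp.existsUnique_continuousMap_lifts P z z' h.symm
    exact ⟨F, hF⟩
  have uniq {F F' : C(Z, Z)} (hF : p ∘ F = p) (hF' : p ∘ F' = p) (z : Z) (h : F z = F' z) :
      F = F' := DFunLike.coe_injective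
    (hp.eq_of_comp_eq F.continuous F'.continuous (hF.trans hF'.symm) z h)
  have : ∀ γ : FundamentalGroup X (q y), ∃ F : C(Z, Z), F z₀ = hp.monodromy γ e₀ ∧ p ∘ F = p :=
    fun γ ↦ lift _ _ (hz₀.trans (hp.monodromy γ e₀).2.symm)
  -- `T γ` is the deck transformation moving `z₀` to the end of the lift of `γ`.
  choose T hT0 hT using this
  have T_one : T 1 = ContinuousMap.id Z :=
    uniq (hT 1) rfl z₀ ((hT0 1).trans congr(($(hp.monodromy_refl) e₀).1))
  have T_mul (γ δ : FundamentalGroup X (q y)) : T (γ * δ) = (T δ).comp (T γ) := by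
    refine uniq (hT _) ?_ z₀ ?_
    · rw [ContinuousMap.coe_comp, ← Function.comp_assoc, hT, hT]
    · rw [hT0, ContinuousMap.comp_apply, hT0]
      have h1 : hp.monodromy (γ * δ : FundamentalGroup X (q y)) e₀ =
        hp.monodromy γ (hp.monodromy δ e₀) := hp.monodromy_trans_apply δ γ e₀
      rw [h1]
      exact monodromy_map_apply hp hp (T δ) (congrFun (hT δ)) γ e₀ (hp.monodromy δ e₀) (hT0 δ)
  -- By `T_mul`, `T` reverses products; the inverse turns it into a left action.
  let A : MulAction G Z :=
    { smul := fun g z ↦ T (b.symm g⁻¹) z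
      one_smul := fun z ↦ by
        change T (b.symm 1⁻¹) z = z
        rw [inv_one, map_one, T_one]; rfl
      mul_smul := fun g h z ↦ by
        change T (b.symm (g * h)⁻¹) z = T (b.symm g⁻¹) (T (b.symm h⁻¹) z)
        rw [mul_inv_rev, map_mul, T_mul]; rfl }
  have smul_def (g : G) (z : Z) : g • z = T (b.symm g⁻¹) z := rfl
  obtain ⟨r, ⟨hr0, hr⟩, -⟩ := hq.existsUnique_continuousMap_lifts P z₀ y hz₀.symm
  have hr' (z : Z) : q (r z) = p z := congrFun hr z
  refine ⟨A, r, ⟨fun g ↦ (T _).continuous⟩, fun z z' ↦ ⟨fun h ↦ ?_, ?_⟩, fun g z h ↦ ?_, hr',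
    fun w ↦ ?_, fun g z ↦ ?_⟩
  · obtain ⟨F, hFz, hF⟩ := lift z z' h
    have hF0 : p (F z₀) = q y := (congrFun hF z₀).trans hz₀
    obtain ⟨γ, hγ⟩ := hp.exists_monodromy_eq e₀ ⟨F z₀, hF0⟩
    have hTF : T γ = F := uniq (hT γ) hF z₀ ((hT0 γ).trans congr(($hγ).1))
    exact ⟨(b γ)⁻¹, by rw [smul_def, inv_inv, b.symm_apply_apply, hTF, hFz]⟩
  · rintro ⟨g, rfl⟩
    exact (congrFun (hT _) z).symm
  · have hid : T (b.symm g⁻¹) = ContinuousMap.id Z := uniq (hT _) rfl z h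
    have h0 : (hp.monodromy (b.symm g⁻¹) e₀ : Z) = z₀ := by rw [← hT0, hid]; rfl
    have h2 : b.symm g⁻¹ = 1 := hp.eq_refl_of_monodromy_eq (b.symm g⁻¹) e₀ (Subtype.ext h0)
    exact inv_eq_one.mp ((map_eq_one_iff b.symm b.symm.injective).mp h2)
  · obtain ⟨Γ⟩ : Nonempty (Path y w) := PathConnectedSpace.joined _ _
    have h1 := hq.monodromy_map (.mk Γ)
    have h2 := monodromy_map_apply hp hq r hr' ((Path.Homotopic.Quotient.mk Γ).map q) e₀ ⟨y, rfl⟩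
      hr0
    exact ⟨_, h2.symm.trans congr(($h1).1)⟩
  · let γ := b.symm g⁻¹
    have hgH : g ∈ H ↔ γ ∈ (FundamentalGroup.map q y).range := by
      rw [← hb, b.apply_symm_apply, inv_mem_iff]
    -- Both sides are lifts of `p` through `q`, so agreement at one point is agreement everywhere.
    -- At `z₀` it says that the lift of `γ` to `Y` from `y` closes up.
    have hz : r (g • z) = r z ↔ r (T γ z₀) = r z₀ := by
      constructor <;> intro h
      · exact congrFun (hq.eq_of_comp_eq (r.comp (T γ)).continuous r.continuous
          (funext fun z ↦ (hr' _).trans ((congrFun (hT γ) z).trans (hr' z).symm)) z h) z₀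
      · exact congrFun (hq.eq_of_comp_eq (r.comp (T γ)).continuous r.continuous
          (funext fun z ↦ (hr' _).trans ((congrFun (hT γ) z).trans (hr' z).symm)) z₀ h) z
    have h2 := monodromy_map_apply hp hq r hr' γ e₀ ⟨y, rfl⟩ hr0
    rw [hz, hgH, hT0, ← h2, hr0]
    constructor
    · intro h
      obtain ⟨δ, hδ⟩ := hq.exists_map_eq_of_monodromy_eq γ ⟨y, rfl⟩ ⟨y, rfl⟩ (Subtype.ext h)
      exact ⟨δ, hδ.trans (Path.Homotopic.Quotient.cast_rfl_rfl _)⟩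
    · rintro ⟨δ, hδ⟩
      rw [← hδ]
      exact congr(($(hq.monodromy_map δ)).1)

end IsCoveringMap

/-! ### Sections and equivariant maps to the coset space -/

section Sections

variable {G Z X Y : Type*} [Group G] [TopologicalSpace G] {H : Subgroup G}
  [TopologicalSpace Z] [TopologicalSpace X] [TopologicalSpace Y] [MulAction G Z]
  [ContinuousConstSMul G Z] {p : Z → X} {q : C(Y, X)} {r : C(Z, Y)}

/-- A section over `V` of the cover `Y = Z / H` yields an equivariant map to `G ⧸ H`. -/
theorem exists_equivariant_map_quotient_of_section
    (horb : ∀ z z', p z = p z' ↔ ∃ g : G, g • z = z') (hp : Continuous p)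
    (hqr : ∀ z, q (r z) = p z) (hr : Function.Surjective r)
    (hH : ∀ (g : G) z, r (g • z) = r z ↔ g ∈ H) (hq : IsCoveringMap q)
    {U : Set Z} {V : Set X} (hUV : U = p ⁻¹' V) (s : C(V, Y)) (hs : ∀ x, q (s x) = x) :
    ∃ φ : C(U, G ⧸ H), ∀ (g : G) (x y : U), (y : Z) = g • (x : Z) → φ y = g • φ x := by
  subst hUV
  have hp_smul (g : G) (z : Z) : p (g • z) = p z := ((horb _ _).mpr ⟨g, rfl⟩).symm
  have (z : p ⁻¹' V) : ∃ g : G, r (g • (z : Z)) = s ⟨p z, z.2⟩ := by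
    obtain ⟨w, hw⟩ := hr (s ⟨p z, z.2⟩)
    obtain ⟨g, hg⟩ := (horb z w).mp (by rw [← hqr w, hw, hs])
    exact ⟨g, by rw [hg, hw]⟩
  choose a ha using this
  -- The element `a z` is unique up to left multiplication by `H`, so the coset of its inverse is
  -- well defined.
  let φ : p ⁻¹' V → G ⧸ H := fun z ↦ (((a z)⁻¹ : G) : G ⧸ H)
  have key (z : p ⁻¹' V) (g : G) (hg : r (g • (z : Z)) = s ⟨p z, z.2⟩) :
      φ z = ((g⁻¹ : G) : G ⧸ H) := by
    refine QuotientGroup.eq.mpr ?_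
    have h := (hH (g * (a z)⁻¹) (a z • (z : Z))).mp
      (by rw [← mul_smul, inv_mul_cancel_right, hg, ha])
    simpa using H.inv_mem h
  have hφ : Continuous φ := by
    refine (IsLocallyConstant.iff_eventually_eq φ).mpr (fun z ↦ ?_) |>.continuous
    -- Two lifts of one map through a covering agree on an open set, so the same `a z` serves for
    -- all nearby points.
    have hopen : IsOpen {z' : p ⁻¹' V | r (a z • (z' : Z)) = s ⟨p z', z'.2⟩} := by
      refine hq.isLocalHomeomorph.isLocallyInjective.isOpen_eqLocus
        (g₁ := fun z' : p ⁻¹' V ↦ r (a z • (z' : Z))) (g₂ := fun z' ↦ s ⟨p z', z'.2⟩) ?_ ?_ ?_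
      · exact r.continuous.comp (continuous_subtype_val.const_smul _)
      · exact s.continuous.comp ((hp.comp continuous_subtype_val).subtype_mk _)
      · funext z'
        simp [hqr, hp_smul, hs]
    filter_upwards [hopen.mem_nhds (ha z)] with z' hz'
    exact key z' (a z) hz'
  refine ⟨⟨φ, hφ⟩, fun g x y hy ↦ ?_⟩
  have : (⟨p y, y.2⟩ : V) = ⟨p x, x.2⟩ := Subtype.ext (by simp [hy, hp_smul])
  refine (key y (a x * g⁻¹) ?_).trans ?_
  · rw [this, hy, ← mul_smul, inv_mul_cancel_right, ha]
  · rw [mul_inv_rev, inv_inv]; rfl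

/-- An equivariant map to `G ⧸ H` yields a section of the cover `Y = Z / H`. -/
theorem exists_section_of_equivariant_map_quotient [DiscreteTopology G]
    (horb : ∀ z z', p z = p z' ↔ ∃ g : G, g • z = z') (hp : IsOpenQuotientMap p)
    (hqr : ∀ z, q (r z) = p z) (hH : ∀ (g : G) z, r (g • z) = r z ↔ g ∈ H)
    {U : Set Z} {V : Set X} (hUV : U = p ⁻¹' V) (φ : C(U, G ⧸ H))
    (hφ : ∀ (g : G) (x y : U), (y : Z) = g • (x : Z) → φ y = g • φ x) :
    ∃ s : C(V, Y), ∀ x, q (s x) = x := by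
  subst hUV
  have hquot : IsOpenQuotientMap (V.restrictPreimage p) := hp.restrictPreimage V
  choose l hl using hquot.surjective
  -- If `φ z` is the coset of `g`, then `r (g⁻¹ • z)` depends neither on `g`, as `r` is
  -- `H`-invariant, nor on the lift `z`, as `φ` is equivariant.
  let s : V → Y := fun x ↦ r ((φ (l x)).out⁻¹ • (l x : Z))
  have hpl (x : V) : p (l x) = x := congrArg Subtype.val (hl x)
  have key (z : p ⁻¹' V) (g : G) (hg : (g : G ⧸ H) = φ z) :
      s (V.restrictPreimage p z) = r (g⁻¹ • (z : Z)) := by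
    set x := V.restrictPreimage p z
    obtain ⟨k, hk⟩ := (horb z (l x)).mp (hpl x).symm
    have h1 : ((φ (l x)).out : G ⧸ H) = ((k * g : G) : G ⧸ H) := by
      rw [QuotientGroup.out_eq', hφ k z (l x) hk.symm, ← hg]; rfl
    have h2 := QuotientGroup.eq.mp h1
    rw [← hH _ (g⁻¹ • (z : Z)), ← mul_smul] at h2
    rw [← h2]
    change r (_ • (l x : Z)) = _
    rw [← hk, ← mul_smul]
    simp [mul_assoc]
  have hs : Continuous s := by
    rw [hquot.isQuotientMap.continuous_iff, continuous_iff_continuousAt]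
    intro z
    have hcont : Continuous fun z' : p ⁻¹' V ↦ r ((φ z).out⁻¹ • (z' : Z)) :=
      r.continuous.comp (continuous_subtype_val.const_smul _)
    refine hcont.continuousAt.congr ?_
    have : DiscreteTopology (G ⧸ H) := QuotientGroup.discreteTopology (isOpen_discrete _)
    have hev : ∀ᶠ z' in 𝓝 z, φ z' = φ z :=
      φ.continuous.continuousAt.eventually ((isOpen_discrete {φ z}).mem_nhds rfl)
    filter_upwards [hev] with z' hz'
    exact (key z' _ (by rw [QuotientGroup.out_eq', hz'])).symm
  refine ⟨⟨s, hs⟩, fun x ↦ ?_⟩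
  exact (hqr _).trans (((horb _ _).mpr ⟨_, rfl⟩).symm.trans (hpl x))

/-- Up to homotopy, sections of a covering are strict. -/
theorem IsCoveringMap.exists_section_of_homotopic (hq : IsCoveringMap q) {V : Set X} (s : C(V, Y))
    (hs : (q.comp s).Homotopic (⟨Subtype.val, continuous_subtype_val⟩ : C(V, X))) :
    ∃ s' : C(V, Y), ∀ x, q (s' x) = x := by
  obtain ⟨F⟩ := hs
  have h0 (x : V) : F.toContinuousMap (0, x) = q (s x) := F.apply_zero x
  -- The homotopy lifts from `s` at time 0; its lift at time 1 covers the inclusion.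
  refine ⟨(hq.liftHomotopy F.toContinuousMap s h0).comp
    ((ContinuousMap.const V 1).prodMk (ContinuousMap.id V)), fun x ↦ ?_⟩
  exact (congrFun (hq.liftHomotopy_lifts F.toContinuousMap s h0) (1, x)).trans (F.apply_one x)

/-- Covers are exchanged by preimage and image under `p`; `G`-invariance is exactly saturation for
`p`. -/
theorem secatLE_iff_genusLE [DiscreteTopology G]
    (horb : ∀ z z', p z = p z' ↔ ∃ g : G, g • z = z') (hp : IsOpenQuotientMap p)
    (hqr : ∀ z, q (r z) = p z) (hr : Function.Surjective r)
    (hH : ∀ (g : G) z, r (g • z) = r z ↔ g ∈ H) (hq : IsCoveringMap q) (k : ℕ) :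
    SecatLE q k ↔ GenusLE G (fun _ : Unit ↦ G ⧸ H) Z k := by
  constructor
  · rintro ⟨V, hVo, hVc, hV⟩
    refine ⟨fun i ↦ p ⁻¹' V i, fun i ↦ (hVo i).preimage hp.continuous, ?_, fun i g x hx ↦ ?_,
      fun i ↦ ⟨(), ?_⟩⟩
    · rw [← preimage_iUnion, hVc, preimage_univ]
    · have : p (g • x) = p x := ((horb _ _).mpr ⟨g, rfl⟩).symm
      simpa only [mem_preimage, this] using hx
    · obtain ⟨s, hs⟩ := hV i
      obtain ⟨s', hs'⟩ := hq.exists_section_of_homotopic s hs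
      exact exists_equivariant_map_quotient_of_section horb hp.continuous hqr hr hH hq rfl s' hs'
  · rintro ⟨U, hUo, hUc, hUG, hU⟩
    refine ⟨fun i ↦ p '' U i, fun i ↦ hp.isOpenMap _ (hUo i), ?_, fun i ↦ ?_⟩
    · rw [← image_iUnion, hUc, image_univ, hp.surjective.range_eq]
    · have hsat : U i = p ⁻¹' (p '' U i) := by
        refine (subset_preimage_image _ _).antisymm ?_
        rintro z ⟨w, hw, hwz⟩
        obtain ⟨g, rfl⟩ := (horb w z).mp hwz
        exact hUG i g w hw
      obtain ⟨_, φ, hφ⟩ := hU i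
      obtain ⟨s, hs⟩ := exists_section_of_equivariant_map_quotient horb hp hqr hH hsat φ hφ
      refine ⟨s, ?_⟩
      have : q.comp s = ⟨Subtype.val, continuous_subtype_val⟩ := ContinuousMap.ext hs
      rw [this]

end Sections

/-! ### Equivariant maps between the two free G-spaces -/

/-- The genus is monotone along equivariant maps. -/
theorem GenusLE.of_equivariant_map {G : Type*} [Group G] {J : Type*} {A : J → Type*}
    [∀ j, TopologicalSpace (A j)] [∀ j, MulAction G (A j)] {Z W : Type*} [TopologicalSpace Z]
    [MulAction G Z] [TopologicalSpace W] [MulAction G W] {k : ℕ} (h : GenusLE G A W k)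
    (f : C(Z, W)) (hf : ∀ (g : G) z, f (g • z) = g • f z) : GenusLE G A Z k := by
  obtain ⟨U, hUo, hUc, hUG, hU⟩ := h
  refine ⟨fun i ↦ f ⁻¹' U i, fun i ↦ (hUo i).preimage f.continuous, ?_, fun i g x hx ↦ ?_,
    fun i ↦ ?_⟩
  · rw [← preimage_iUnion, hUc, preimage_univ]
  · simpa only [mem_preimage, hf] using hUG i g _ hx
  · obtain ⟨j, φ, hφ⟩ := hU i
    refine ⟨j, φ.comp (f.restrictPreimage (U i)), fun g x y hy ↦ hφ g _ _ ?_⟩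
    simp [hy, hf]

open Topology.CWComplex in
/-- A free `G`-CW complex maps equivariantly to every contractible `G`-space. -/
theorem IsGCWComplex.exists_equivariant_map {G E W : Type*} [Group G] [TopologicalSpace E]
    [MulAction G E] (hE : IsGCWComplex G E) (hfree : ∀ x : E, MulAction.stabilizer G x = ⊥)
    [TopologicalSpace W] [MulAction G W] [ContinuousConstSMul G W] [ContractibleSpace W] :
    ∃ f : C(E, W), ∀ (g : G) z, f (g • z) = g • f z := by
  obtain ⟨_, hperm, hfix⟩ := hE.exists_cw
  have := hE.t2Space
  have := hE.continuousConstSMul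
  have hfree' {g : G} {x : E} (h : g • x = x) : g = 1 := by
    have : g ∈ MulAction.stabilizer G x := h
    rwa [hfree x, Subgroup.mem_bot] at this
  let C := Σ n, RelCWComplex.cell (univ : Set E) n
  -- One cell is chosen from each `G`-orbit of cells; these are the free cells.
  let S : Setoid C :=
    { r := fun c c' ↦ c.1 = c'.1 ∧ ∃ g : G, g • openCell c.1 c.2 = openCell c'.1 c'.2
      iseqv :=
        { refl := fun c ↦ ⟨rfl, 1, one_smul _ _⟩
          symm := by
            rintro c c' ⟨h, g, hg⟩
            exact ⟨h.symm, g⁻¹, by rw [← hg, inv_smul_smul]⟩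
          trans := by
            rintro c c' c'' ⟨h, g, hg⟩ ⟨h', g', hg'⟩
            exact ⟨h.trans h', g' * g, by rw [mul_smul, hg, hg']⟩ } }
  let rep : Quotient S → C := Quotient.out
  have rep_spec (c : C) : (rep ⟦c⟧).1 = c.1 ∧
      ∃ g : G, g • openCell (rep ⟦c⟧).1 (rep ⟦c⟧).2 = openCell c.1 c.2 := Quotient.mk_out c
  have cover (x : E) (c : C) (hx : x ∈ openCell c.1 c.2) :
      ∃ g : G, ∃ d ∈ Metric.ball (0 : Fin (rep ⟦c⟧).1 → ℝ) 1,
        g • RelCWComplex.map (C := (univ : Set E)) (rep ⟦c⟧).1 (rep ⟦c⟧).2 d = x := by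
    obtain ⟨-, g, hg⟩ := rep_spec c
    rw [← hg] at hx
    obtain ⟨_, ⟨d, hd, rfl⟩, rfl⟩ := hx
    exact ⟨g, d, hd, rfl⟩
  -- Only open cells are permuted, and characteristic maps need not be translates of each other, so
  -- continuity is carried between closed cells as subsets of `E`.
  have continuousOn_closedCell {f : E → W} (hf : ∀ (g : G) z, f (g • z) = g • f z) (c : C)
      (hc : ContinuousOn (f ∘ map (rep ⟦c⟧).1 (rep ⟦c⟧).2) (Metric.closedBall 0 1)) :
      ContinuousOn (f ∘ map c.1 c.2) (Metric.closedBall 0 1) := by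
    set b := rep ⟦c⟧
    obtain ⟨-, g, hg⟩ := rep_spec c
    have hcell : g • closedCell b.1 b.2 = closedCell c.1 c.2 := by
      rw [← closure_openCell_eq_closedCell, ← closure_openCell_eq_closedCell, ← hg,
        ← Set.image_smul, ← Set.image_smul]
      exact (Homeomorph.smul g).image_closure _
    have hb : ContinuousOn f (closedCell b.1 b.2) := by
      have := continuousOn_inter_of_comp_map (T := closedCell b.1 b.2) (J := {b}) (f := f)
        (by rintro _ rfl; exact subset_rfl)
        (fun A hA h ↦ by simpa [inter_eq_left.mpr hA] using h b rfl) isOpen_univ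
        (by rintro _ rfl; simpa using hc)
      simpa using this
    have hc' : ContinuousOn f (closedCell c.1 c.2) := by
      have h1 : ContinuousOn (fun x ↦ g • f (g⁻¹ • x)) (closedCell c.1 c.2) := by
        refine (hb.comp (continuous_const_smul g⁻¹).continuousOn fun x hx ↦ ?_).const_smul g
        rw [← hcell] at hx
        exact mem_smul_set_iff_inv_smul_mem.mp hx
      exact h1.congr fun x _ ↦ by simp only [← hf, smul_inv_smul]
    exact hc'.comp (RelCWComplex.continuousOn (C := (univ : Set E)) c.1 c.2)
      fun d hd ↦ mem_image_of_mem _ hd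
  refine exists_equivariant_map_of_freeCells (fun i ↦ (rep i).1)
    (fun i ↦ RelCWComplex.map (C := (univ : Set E)) (rep i).1 (rep i).2) ⟨?_, fun x ↦ ?_⟩
    (fun i d hd ↦ ?_) (fun f hf i h ↦ ?_) (fun f hf h ↦ ?_)
  · rintro ⟨g, i, d, hd⟩ ⟨g', i', d', hd'⟩ h
    dsimp only at h
    have hx : (g'⁻¹ * g) • RelCWComplex.map (C := (univ : Set E)) (rep i).1 (rep i).2 d =
        RelCWComplex.map (C := (univ : Set E)) (rep i').1 (rep i').2 d' := by
      rw [mul_smul, h, inv_smul_smul]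
    obtain ⟨e', hc⟩ := hperm (g'⁻¹ * g) (rep i).1 (rep i).2
    have hcell : ⟨(rep i).1, e'⟩ = rep i' := eq_of_mem_openCell
      (hc ▸ hx ▸ smul_mem_smul_set (mem_image_of_mem _ hd)) (mem_image_of_mem _ hd')
    have hii' : i = i' := by
      rw [← Quotient.out_eq i, ← Quotient.out_eq i']
      refine Quotient.sound ⟨?_, g'⁻¹ * g, ?_⟩
      · change (rep i).1 = (rep i').1
        rw [← hcell]
      · exact hc.trans (congrArg (fun c : C ↦ openCell c.1 c.2) hcell)
    subst hii'
    replace hc := hc.trans (congrArg (fun c : C ↦ openCell c.1 c.2) hcell)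
    -- An element preserving a cell fixes it pointwise, hence is trivial because the action is free.
    have hg := hfix _ _ _ hc _ (mem_image_of_mem _ hd)
    have hg1 : g'⁻¹ * g = 1 := hfree' hg
    obtain rfl : g' = g := inv_mul_eq_one.mp hg1
    rw [hg] at hx
    obtain rfl : d = d' := injOn_map (rep i) hd hd' hx
    rfl
  · obtain ⟨c, hc⟩ := exists_mem_openCell x
    obtain ⟨g, d, hd, h⟩ := cover x c hc
    exact ⟨⟨g, ⟦c⟧, d, hd⟩, h⟩
  · obtain ⟨c, hc, hx⟩ := exists_mem_openCell_of_mem_cellFrontier (c := rep i)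
      (mem_image_of_mem _ hd)
    obtain ⟨g, d', hd', h⟩ := cover _ c hx
    exact ⟨g, ⟦c⟧, (rep_spec c).1.trans_lt hc, d', hd', h⟩
  · obtain ⟨J, hJ, hlt, hsub⟩ := exists_finite_cellFrontier_subset (rep i)
    have := continuousOn_inter_of_comp_map (f := f)
      (fun c hc ↦ subset_biUnion_of_mem (u := fun c : C ↦ closedCell c.1 c.2) hc)
      (fun A hA h ↦ isClosed_of_subset_finite_iUnion_closedCell hJ hA h) isOpen_univ
      (fun c hc ↦ by
        simpa using continuousOn_closedCell hf c (h _ ((rep_spec c).1.trans_lt (hlt c hc))))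
    rw [inter_univ] at this
    exact this.comp ((RelCWComplex.continuousOn (C := (univ : Set E)) _ _).mono
      Metric.sphere_subset_closedBall) fun d hd ↦ hsub (mem_image_of_mem _ hd)
  · have := continuousOn_inter_of_comp_map (f := f) (T := univ) (J := univ)
      (fun c _ ↦ subset_univ _) (fun A _ h ↦ isClosed_of_isClosed_inter_closedCell h) isOpen_univ
      (fun c _ ↦ by simpa using continuousOn_closedCell hf c (h _))
    rwa [inter_univ, continuousOn_univ] at this

open Topology.CWComplex in
/-- A regular cover `Z` of a CW complex with group `G` maps equivariantly to every contractible
`G`-space. -/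
theorem IsCoveringMap.exists_equivariant_map {G Z X W : Type*} [Group G] [TopologicalSpace Z]
    [MulAction G Z] [ContinuousConstSMul G Z] [TopologicalSpace X] [T2Space X]
    [CWComplex (univ : Set X)] {p : Z → X} (hp : IsCoveringMap p) (hsurj : Function.Surjective p)
    (horb : ∀ z z', p z = p z' ↔ ∃ g : G, g • z = z')
    (hfree : ∀ (g : G) (z : Z), g • z = z → g = 1)
    [TopologicalSpace W] [MulAction G W] [ContinuousConstSMul G W] [ContractibleSpace W] :
    ∃ f : C(Z, W), ∀ (g : G) z, f (g • z) = g • f z := by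
  let C := Σ n, RelCWComplex.cell (univ : Set X) n
  have hp_smul (g : G) (z : Z) : p (g • z) = p z := ((horb _ _).mpr ⟨g, rfl⟩).symm
  -- The clamped characteristic map lives on a Euclidean space, which is simply connected, so it
  -- lifts to `Z`.
  have (c : C) : ∃ φ : C(Fin c.1 → ℝ, Z), ∀ d, p (φ d) = map c.1 c.2 (clamp d) := by
    obtain ⟨z, hz⟩ := hsurj (map c.1 c.2 (clamp 0))
    obtain ⟨φ, ⟨-, hφ⟩, -⟩ := hp.existsUnique_continuousMap_lifts
      (⟨_, continuous_map_clamp c⟩ : C(Fin c.1 → ℝ, X)) 0 z hz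
    exact ⟨φ, congrFun hφ⟩
  choose φ hφ using this
  have hφ' (c : C) {d : Fin c.1 → ℝ} (hd : d ∈ Metric.closedBall 0 1) :
      p (φ c d) = map c.1 c.2 d := by rw [hφ, clamp_of_mem hd]
  have cover (z : Z) (c : C) (hz : p z ∈ openCell c.1 c.2) :
      ∃ g : G, ∃ d ∈ Metric.ball (0 : Fin c.1 → ℝ) 1, g • φ c d = z := by
    obtain ⟨d, hd, h⟩ := hz
    obtain ⟨g, hg⟩ := (horb (φ c d) z).mp ((hφ' c (Metric.ball_subset_closedBall hd)).trans h)
    exact ⟨g, d, hd, hg⟩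
  have continuousOn_preimage {f : Z → W} (hf : ∀ (g : G) z, f (g • z) = g • f z) {T : Set X}
      {J : Set C} (hJ : ∀ c ∈ J, closedCell c.1 c.2 ⊆ T)
      (hT : ∀ A ⊆ T, (∀ c ∈ J, IsClosed (A ∩ closedCell c.1 c.2)) → IsClosed A)
      (hc : ∀ c ∈ J, ContinuousOn (f ∘ φ c) (Metric.closedBall 0 1)) :
      ContinuousOn f (p ⁻¹' T) := by
    intro z hz
    obtain ⟨e, hze, rfl⟩ := hp.isLocalHomeomorph z
    have hloc : ContinuousOn (f ∘ e.symm) (T ∩ e.target) := by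
      -- Within a sheet, the characteristic map followed by `e.symm` is locally a fixed translate `g
      -- • φ c`, so equivariance transfers continuity from `f ∘ φ c`.
      refine continuousOn_inter_of_comp_map hJ hT e.open_target fun c hcJ d hd ↦ ?_
      have hd' : e (e.symm (map c.1 c.2 d)) = map c.1 c.2 d := e.right_inv hd.2
      obtain ⟨g, hg⟩ := (horb (φ c d) (e.symm (map c.1 c.2 d))).mp
        ((hφ' c hd.1).trans hd'.symm)
      have hcont : Continuous fun d' ↦ g • φ c d' := (φ c).continuous.const_smul g
      have hmem : ∀ᶠ d' in 𝓝 d, g • φ c d' ∈ e.source :=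
        hcont.continuousAt.eventually
          (e.open_source.mem_nhds (show g • φ c d ∈ e.source from hg ▸ e.map_target hd.2))
      have hev {d'} (hd' : g • φ c d' ∈ e.source) (hb : d' ∈ Metric.closedBall 0 1) :
          (f ∘ e.symm ∘ map c.1 c.2) d' = g • f (φ c d') := by
        rw [← hf]
        refine congrArg f ?_
        rw [Function.comp_apply, ← hφ' c hb, ← hp_smul g, e.left_inv hd']
      refine ContinuousWithinAt.congr_of_eventuallyEq
        (((hc c hcJ).mono inter_subset_left d hd).const_smul g) ?_ (hev hmem.self_of_nhds hd.1)
      filter_upwards [mem_nhdsWithin_of_mem_nhds hmem, self_mem_nhdsWithin] with d' h1 h2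
      exact hev h1 h2.1
    have hcomp : ContinuousWithinAt (f ∘ e.symm ∘ e) (e ⁻¹' T ∩ e.source) z :=
      ContinuousWithinAt.comp (g := f ∘ e.symm) (t := T ∩ e.target)
        (hloc (e z) ⟨hz, e.map_source hze⟩)
        (e.continuousAt hze).continuousWithinAt fun w hw ↦ ⟨hw.1, e.map_source hw.2⟩
    rw [continuousWithinAt_inter (e.open_source.mem_nhds hze)] at hcomp
    refine hcomp.congr_of_eventuallyEq ?_ (by simp [e.left_inv hze])
    filter_upwards [mem_nhdsWithin_of_mem_nhds (e.open_source.mem_nhds hze)] with w hw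
    simp [e.left_inv hw]
  refine exists_equivariant_map_of_freeCells (I := C) (fun c ↦ c.1) (fun c ↦ φ c)
    ⟨?_, fun z ↦ ?_⟩ (fun c d hd ↦ ?_) (fun f hf c h ↦ ?_) (fun f hf h ↦ ?_)
  · rintro ⟨g, c, d, hd⟩ ⟨g', c', d', hd'⟩ h
    dsimp only at h
    have hx := congrArg p h
    rw [hp_smul, hp_smul, hφ' c (Metric.ball_subset_closedBall hd),
      hφ' c' (Metric.ball_subset_closedBall hd')] at hx
    obtain rfl : c = c' :=
      eq_of_mem_openCell (mem_image_of_mem _ hd) (hx ▸ mem_image_of_mem _ hd')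
    obtain rfl : d = d' := injOn_map c hd hd' hx
    have h1 : g'⁻¹ * g = 1 := hfree _ (φ c d) (by rw [mul_smul, h, inv_smul_smul])
    obtain rfl : g' = g := inv_mul_eq_one.mp h1
    rfl
  · obtain ⟨c, hc⟩ := exists_mem_openCell (p z)
    obtain ⟨g, d, hd, h⟩ := cover z c hc
    exact ⟨⟨g, c, d, hd⟩, h⟩
  · obtain ⟨c', hc, hx⟩ := exists_mem_openCell_of_mem_cellFrontier (c := c)
      (mem_image_of_mem _ hd)
    rw [← hφ' c (Metric.sphere_subset_closedBall hd)] at hx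
    obtain ⟨g, d', hd', h⟩ := cover _ c' hx
    exact ⟨g, c', hc, d', hd', h⟩
  · obtain ⟨J, hJ, hlt, hsub⟩ := exists_finite_cellFrontier_subset c
    refine (continuousOn_preimage hf
      (fun c hc ↦ subset_biUnion_of_mem (u := fun c : C ↦ closedCell c.1 c.2) hc)
      (fun A hA h ↦ isClosed_of_subset_finite_iUnion_closedCell hJ hA h)
      (fun c' hc' ↦ h c' (hlt c' hc'))).comp (φ c).continuous.continuousOn fun d hd ↦ ?_
    rw [mem_preimage, hφ' c (Metric.sphere_subset_closedBall hd)]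
    exact hsub (mem_image_of_mem _ hd)
  · have := continuousOn_preimage hf (T := univ) (J := univ)
      (fun c _ ↦ subset_univ _) (fun A _ h ↦ isClosed_of_isClosed_inter_closedCell h)
      (fun c _ ↦ h c)
    rwa [preimage_univ, continuousOn_univ] at this

/-! ### Comparison of sectional category and genus -/

theorem corollary2p3 {G : Type*} [Group G] [TopologicalSpace G] [DiscreteTopology G]
    (hG : ∀ g : G, IsOfFinOrder g → g = 1) (H : Subgroup G)
    {Y X : Type*} [TopologicalSpace Y] [TopologicalSpace X]
    (q : C(Y, X)) (hq : IsEilenbergMacLaneMap H q)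
    {E : Type*} [TopologicalSpace E] [MulAction G E] (hE : IsEG G E) :
    secat q = genus G (fun _ : Unit => G ⧸ H) E := by
  have := hq.target.t2Space
  have := hq.target.pathConnectedSpace
  have := hq.source.pathConnectedSpace
  have := hE.contractibleSpace
  have := hE.isGCWComplex.continuousConstSMul
  obtain ⟨_⟩ := hq.target.nonempty_cw
  obtain ⟨Z, _, p, hp, _⟩ := hq.target.exists_cover
  have := CWComplex.locallyPathConnectedSpace X
  have := hp.locallyPathConnectedSpace
  obtain ⟨y, a, b, hab⟩ := hq.exists_induces
  have hb (γ : FundamentalGroup X (q y)) :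
      b γ ∈ H ↔ γ ∈ (FundamentalGroup.map q y).range := by
    constructor
    · intro h
      refine ⟨a.symm ⟨b γ, h⟩, b.injective ?_⟩
      rw [hab, a.apply_symm_apply]
    · rintro ⟨δ, rfl⟩
      rw [hab]
      exact (a δ).2
  obtain ⟨_, r, _, horb, hfree, hqr, hr, hH⟩ :=
    hp.exists_mulAction_of_simplyConnectedSpace H q hq.isCoveringMap y b hb
  have hsurj := hp.surjective_of_pathConnectedSpace
  obtain ⟨f, hf⟩ :=
    hE.isGCWComplex.exists_equivariant_map (W := Z) hE.stabilizer_eq_bot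
  obtain ⟨f', hf'⟩ := hp.exists_equivariant_map (W := E) hsurj horb hfree
  have key (k : ℕ) : SecatLE q k ↔ GenusLE G (fun _ : Unit ↦ G ⧸ H) E k :=
    (secatLE_iff_genusLE horb ⟨hsurj, hp.continuous, hp.isOpenMap⟩ hqr hr hH
      hq.isCoveringMap k).trans
      ⟨fun h ↦ h.of_equivariant_map f hf, fun h ↦ h.of_equivariant_map f' hf'⟩
  simp only [secat, genus, key]
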